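/- A (finite, undirected) hyper-graph $\mathcal H=(V,\mathcal E)$ is a finite set $V$ of vertices with a set $\mathcal E\subseteq 2^V$ of hyper-edges; its rank is the maximum cardinality of a hyper-edge, and it is connected if any two vertices are joined by a chain of hyper-edges in which consecutive ones intersect. The simple random walk on $\mathcal H$ from $v$ has $X(0)=v$; at each time $t\in\{0,1,2,\dots\}$ it chooses $e(t)$ uniformly among the hyper-edges that contain $X(t)$, and then $X(t+1)$ uniformly among the vertices of $e(t)$. For a vertex $u$ let $T^u_v=\inf\{t\ge 0: X(t)=u\}$ and $\widetilde T^u_v=\inf\{t\ge 0: u\in e(t)\}$ for the walk from $v$. The cover time, the radio cover time and the (maximum) radio hitting time of $\mathcal H$ are $$C=\max_{v}\mathbb E\big[\max_u T^u_v\big],\qquad \widetilde C=\max_{v}\mathbb E\big[\max_u \widetilde T^u_v\big],\qquad \widetilde h_{\max}=\max_{u,v}\mathbb E\big[\widetilde T^u_v\big].$$ There is an absolute constant $\kappa>0$ such that for all integers $n,c$ with $2\le c\le n/2$ there is a connected hyper-graph $\mathcal H=(V,\mathcal E)$ with $|V|=n$ vertices, $m=|\mathcal E|$ hyper-edges and rank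 $c$ for which $$C\;\ge\;\widetilde C\;\ge\;\widetilde h_{\max}\;\ge\;\kappa\, m\, n\, c .$$ Moreover, $\mathcal H$ can be taken to be the $c$-uniform hyper-clique on $\lfloor n/2\rfloor+1$ vertices (the hyper-edges are all $c$-element subsets of these vertices) glued at one vertex to an end of a hyper-line (a path whose hyper-edges are the pairs of consecutive vertices) that contains the remaining vertices. -/

import Mathlib

open MeasureTheory ProbabilityTheory
open scoped ENNReal NNReal

namespace Hypergraph

/-- A state of the random walk on a hyper-graph: the current vertex `X(t)` together with the
hyper-edge `e(t)` along which the walk makes its next move. -/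
structure WalkState (α : Type*) where
  /-- The vertex `X(t)`. -/
  vertex : α
  /-- The hyper-edge `e(t)` traversed between the times `t` and `t + 1`. -/
  edge : Set α

theorem WalkState.pair_injective {α : Type*} :
    Function.Injective (fun s : WalkState α => (s.vertex, s.edge)) := by
  rintro ⟨x, e⟩ ⟨y, f⟩ h
  simpa using h

instance {α : Type*} [Finite α] : Finite (WalkState α) :=
  Finite.of_injective _ WalkState.pair_injective

instance {α : Type*} : MeasurableSpace (WalkState α) := ⊤

instance {α : Type*} : DiscreteMeasurableSpace (WalkState α) := ⟨fun _ => trivial⟩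

section

variable {α : Type*}

/-- The rank: the maximal cardinality of a hyper-edge. -/
noncomputable def rank (H : Hypergraph α) : ℕ∞ := ⨆ e ∈ H.edgeSet, e.encard

/-- The set `ℰ(x)` of hyper-edges that contain `x`. -/
def edgesAt (H : Hypergraph α) (x : α) : Set (Set α) := {e ∈ H.edgeSet | x ∈ e}

/-- Any two vertices are joined by a hyper-path. -/
def Connected (H : Hypergraph α) : Prop :=
  H.vertexSet.Nonempty ∧
    ∀ u ∈ H.vertexSet, ∀ v ∈ H.vertexSet, Relation.ReflTransGen H.Adj u v

open Classical in
/-- The uniform distribution on `s`, or the point mass at `b` if `s` is empty. -/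
noncomputable def uniformOr {β : Type*} [Finite β] (s : Set β) (b : β) : PMF β :=
  if h : s.Nonempty then
    PMF.uniformOfFinset s.toFinite.toFinset (s.toFinite.toFinset_nonempty.2 h)
  else PMF.pure b

/-- The first time at which the trajectory `ω` visits `u` (infinite if there is none). -/
noncomputable def visitTime (u : α) (ω : ℕ → WalkState α) : ℝ≥0∞ :=
  ⨅ (t : ℕ) (_ : (ω t).vertex = u), (t : ℝ≥0∞)

/-- The first time `t` at which the trajectory `ω` is heard by `u`, that is, `u ∈ e(t)` (infinite
if there is none). -/
noncomputable def hearTime (u : α) (ω : ℕ → WalkState α) : ℝ≥0∞ :=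
  ⨅ (t : ℕ) (_ : u ∈ (ω t).edge), (t : ℝ≥0∞)

/-- `H` consists of the `c`-uniform hyper-clique on a set `K` of `a` vertices (its hyper-edges are
all the `c`-element subsets of `K`) and of a hyper-line `p 0, p 1, …, p ℓ` (its hyper-edges are
the pairs of consecutive vertices), glued together at the end `p 0` of the hyper-line, which is
the only vertex that they share. -/
def IsCliqueLineGluing (H : Hypergraph α) (c a : ℕ) : Prop :=
  ∃ (K : Set α) (ℓ : ℕ) (p : Fin (ℓ + 1) → α),
    K.encard = a ∧ Function.Injective p ∧ K ∩ Set.range p = {p 0} ∧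
    H.vertexSet = K ∪ Set.range p ∧
    H.edgeSet = {e | e ⊆ K ∧ e.encard = c} ∪
      Set.range (fun i : Fin ℓ => {p i.castSucc, p i.succ})

end

section

variable {α : Type*} [Finite α]

/-- The law of the state `(x, e)` of the walk when it is at the vertex `x`: the hyper-edge `e` is
uniform in `ℰ(x)`. (At an isolated vertex the walk uses the empty edge and stays where it is.) -/
noncomputable def arrive (H : Hypergraph α) (x : α) : PMF (WalkState α) :=
  (uniformOr (H.edgesAt x) ∅).map (fun e => ⟨x, e⟩)

/-- One step of the simple random walk: from the state `(X(t), e(t))`, the vertex `X(t + 1)` is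
uniform in `e(t)`, and then `e(t + 1)` is uniform in `ℰ(X(t + 1))`. -/
noncomputable def step (H : Hypergraph α) (s : WalkState α) : PMF (WalkState α) :=
  (uniformOr s.edge s.vertex).bind H.arrive

/-- The transition kernel of the Markov chain `(X(t), e(t))`. -/
noncomputable def stepKernel (H : Hypergraph α) : Kernel (WalkState α) (WalkState α) :=
  Kernel.ofFunOfCountable (fun s => (H.step s).toMeasure)

instance (H : Hypergraph α) : IsMarkovKernel H.stepKernel :=
  ⟨fun s => PMF.toMeasure.isProbabilityMeasure (H.step s)⟩

/-- The transition kernel out of the whole past up to time `t`; it looks at the last state only. -/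
noncomputable def pastKernel (H : Hypergraph α) (t : ℕ) :
    Kernel ((_ : Finset.Iic t) → WalkState α) (WalkState α) :=
  H.stepKernel.comap (fun h => h ⟨t, Finset.mem_Iic.2 le_rfl⟩) (measurable_pi_apply _)

instance (H : Hypergraph α) (t : ℕ) : IsMarkovKernel (H.pastKernel t) := by
  unfold pastKernel
  infer_instance

/-- The law, on the space of trajectories, of the simple random walk `(X(t), e(t))`, `t ∈ ℕ`, with
`X(0) = v`. -/
noncomputable def walkLaw (H : Hypergraph α) (v : α) : Measure (ℕ → WalkState α) :=
  Kernel.trajMeasure (X := fun _ => WalkState α) (H.arrive v).toMeasure H.pastKernel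

/-- The radio hitting time from `v` to `u`: the expected time until the walk that starts at `v` is
heard by `u`. -/
noncomputable def radioHittingTime (H : Hypergraph α) (v u : α) : ℝ≥0∞ :=
  ∫⁻ ω, hearTime u ω ∂(H.walkLaw v)

/-- The maximum radio hitting time. -/
noncomputable def maxRadioHittingTime (H : Hypergraph α) : ℝ≥0∞ :=
  ⨆ v ∈ H.vertexSet, ⨆ u ∈ H.vertexSet, H.radioHittingTime v u

/-- The cover time: the expected time until all vertices have been visited, from the worst
starting vertex. -/
noncomputable def coverTime (H : Hypergraph α) : ℝ≥0∞ :=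
  ⨆ v ∈ H.vertexSet, ∫⁻ ω, (⨆ u ∈ H.vertexSet, visitTime u ω) ∂(H.walkLaw v)

/-- The radio cover time: the expected time until all vertices have heard the walk, from the worst
starting vertex. -/
noncomputable def radioCoverTime (H : Hypergraph α) : ℝ≥0∞ :=
  ⨆ v ∈ H.vertexSet, ∫⁻ ω, (⨆ u ∈ H.vertexSet, hearTime u ω) ∂(H.walkLaw v)

end

end Hypergraph

namespace Hypergraph

/-! The first two inequalities compare times on a trajectory: a visit at time `t` is heard at time
`t`, and a supremum over `u` dominates each term. The lower bound needs an explicit potential `g` on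
the vertices. If `g` at each vertex is at most the average over the next edge `e` of `0` (when the
target `u` lies in `e`) or `1 +` the mean of `g` on `e`, then optional stopping gives `g v ≤
H.radioHittingTime v u` (`lintegral_arrive_le_radioHittingTime`, `le_radioHittingTime`).

For the target at the far end of the line, let `N = q.choose (c - 1)` be the number of clique edges
at a clique vertex. Off the glue vertex `g` is larger than at the glue vertex by `c * q / (c - 1)`,
which makes the inequality an equality there. At the glue vertex each of the `N` clique edges then
contributes `q + 1` more than `g`, a total excess `R = N * (q + 1)`. The single line edge there may
lose `R`, so `g` may fall by `2 * R` per step of the line (`potential_superharmonic`). Thus `g` at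
the glue vertex is `R * (2 * ℓ - 1)`. Since `R = c * (q + 1).choose c`, and `m` is at most twice
this binomial coefficient, this is of order `m n c`. -/

/-! ### Averages over discrete laws. -/

theorem tsum_bind_mul {β γ : Type*} (p : PMF β) (q : β → PMF γ) (f : γ → ℝ≥0∞) :
    ∑' y, (p.bind q) y * f y = ∑' x, p x * ∑' y, q x y * f y := by
  simp_rw [PMF.bind_apply, ← ENNReal.tsum_mul_right, ← ENNReal.tsum_mul_left]
  rw [ENNReal.tsum_comm]
  simp_rw [mul_assoc]

theorem tsum_map_mul {β γ : Type*} (p : PMF β) (h : β → γ) (f : γ → ℝ≥0∞) :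
    ∑' y, (p.map h) y * f y = ∑' x, p x * f (h x) := by
  rw [PMF.map, tsum_bind_mul]
  congr with x
  congr 1
  rw [tsum_eq_single (h x)]
  · simp
  · intro y hy
    simp [hy]

theorem lintegral_pmf {β : Type*} [Countable β] [MeasurableSpace β] [MeasurableSingletonClass β]
    (p : PMF β) (f : β → ℝ≥0∞) : ∫⁻ x, f x ∂p.toMeasure = ∑' x, p x * f x := by
  rw [lintegral_countable']
  congr with x
  rw [PMF.toMeasure_apply_singleton _ _ (measurableSet_singleton x), mul_comm]

/-- Averages with respect to `uniformOr` over an injective image of a finite set. -/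
theorem tsum_uniformOr_mul {β γ : Type*} [Finite β] (s : Finset γ) (hs : s.Nonempty) (i : γ → β)
    (hi : Function.Injective i) (b : β) (f : β → ℝ≥0∞) :
    ∑' x, uniformOr (i '' s) b x * f x = (∑ x ∈ s, f (i x)) / s.card := by
  classical
  have hne : (i '' (s : Set γ)).Nonempty := (Finset.coe_nonempty.2 hs).image i
  have hfin : (i '' (s : Set γ)).toFinite.toFinset = s.image i := by
    ext; simp
  rw [uniformOr, dif_pos hne, tsum_eq_sum (s := s.image i)]
  · rw [Finset.sum_image (fun x _ y _ h => hi h), div_eq_mul_inv, mul_comm, Finset.mul_sum]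
    refine Finset.sum_congr rfl fun x hx => ?_
    rw [PMF.uniformOfFinset_apply_of_mem]
    · rw [hfin, Finset.card_image_of_injective _ hi]
    · rw [hfin]
      exact Finset.mem_image_of_mem i hx
  · intro x hx
    rw [PMF.uniformOfFinset_apply_of_notMem, zero_mul]
    rwa [hfin]

/-! ### Tails of the hearing time. -/

section

variable {α : Type*}

/-- The trajectories that `u` has not heard up to and including time `N`. -/
def unheard (u : α) (N : ℕ) : Set (ℕ → WalkState α) := {ω | ∀ t ≤ N, u ∉ (ω t).edge}

theorem measurableSet_unheard (u : α) (N : ℕ) : MeasurableSet (unheard u N) := by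
  have : unheard u N = ⋂ t : ℕ, ⋂ _ : t ≤ N,
      (fun ω : ℕ → WalkState α => ω t) ⁻¹' {s | u ∉ s.edge} := by
    ext; simp [unheard]
  rw [this]
  exact MeasurableSet.iInter fun t => MeasurableSet.iInter fun _ =>
    measurable_pi_apply t (MeasurableSet.of_discrete)

/-- A time is the sum of its tail indicators; only a partial sum is needed, which also covers an
infinite hearing time. -/
theorem sum_indicator_unheard_le (u : α) (N : ℕ) (ω : ℕ → WalkState α) :
    ∑ t ∈ Finset.range N, (unheard u t).indicator 1 ω ≤ hearTime u ω := by
  classical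
  refine le_iInf₂ fun t ht => ?_
  calc ∑ s ∈ Finset.range N, (unheard u s).indicator 1 ω
      ≤ ∑ s ∈ Finset.range N, if s < t then (1 : ℝ≥0∞) else 0 := by
        refine Finset.sum_le_sum fun s _ => ?_
        split_ifs with h
        · exact Set.indicator_apply_le' (fun _ => le_rfl) (fun _ => zero_le)
        · rw [Set.indicator_of_notMem]
          exact fun hs => hs t (not_lt.1 h) ht
    _ ≤ ∑ s ∈ Finset.range t, 1 := by
        rw [← Finset.sum_filter]
        exact Finset.sum_le_sum_of_subset fun s hs => by simp at hs ⊢; exact hs.2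
    _ = t := by simp

/-- The pointwise form of Markov's inequality. -/
theorem mul_indicator_unheard_le (u : α) (N : ℕ) (ω : ℕ → WalkState α) :
    (N : ℝ≥0∞) * (unheard u N).indicator 1 ω ≤ hearTime u ω := by
  refine le_iInf₂ fun t ht => ?_
  by_cases h : ω ∈ unheard u N
  · rw [Set.indicator_of_mem h, Pi.one_apply, mul_one]
    have : N < t := by
      by_contra h'
      exact h t (not_lt.1 h') ht
    exact_mod_cast this.le
  · simp [h]

end

/-! ### The law of the walk, its Markov property, and optional stopping. -/

section

variable {α : Type*} [Finite α]

theorem lintegral_arrive (H : Hypergraph α) (x : α) (F : WalkState α → ℝ≥0∞) :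
    ∫⁻ s, F s ∂(H.arrive x).toMeasure = ∑' e, uniformOr (H.edgesAt x) ∅ e * F ⟨x, e⟩ := by
  rw [lintegral_pmf, arrive, tsum_map_mul]

theorem lintegral_step (H : Hypergraph α) (s : WalkState α) (F : WalkState α → ℝ≥0∞) :
    ∫⁻ s', F s' ∂(H.step s).toMeasure =
      ∑' y, uniformOr s.edge s.vertex y * ∫⁻ s', F s' ∂(H.arrive y).toMeasure := by
  simp_rw [lintegral_pmf]
  rw [step, tsum_bind_mul]

instance (H : Hypergraph α) (v : α) : IsProbabilityMeasure (H.walkLaw v) := by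
  have : IsProbabilityMeasure (H.arrive v).toMeasure :=
    PMF.toMeasure.isProbabilityMeasure _
  unfold walkLaw
  infer_instance

theorem lintegral_walkLaw_zero (H : Hypergraph α) (v : α) (F : WalkState α → ℝ≥0∞) :
    ∫⁻ ω, F (ω 0) ∂(H.walkLaw v) = ∫⁻ s, F s ∂(H.arrive v).toMeasure := by
  have hF : Measurable F := Measurable.of_discrete
  have key : (H.walkLaw v).map (Preorder.frestrictLe 0) =
      (H.arrive v).toMeasure.map
        (MeasurableEquiv.piUnique (fun _ : Finset.Iic 0 => WalkState α)).symm := by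
    unfold walkLaw Kernel.trajMeasure
    rw [Measure.map_comp _ _ (by fun_prop), Kernel.traj_map_frestrictLe, Kernel.partialTraj_self,
      Measure.id_comp]
  have h0 : ∀ ω : ℕ → WalkState α,
      F (ω 0) = (fun h : (_ : Finset.Iic 0) → WalkState α => F (h ⟨0, Finset.mem_Iic.2 le_rfl⟩))
        (Preorder.frestrictLe 0 ω) := fun ω => rfl
  simp_rw [h0]
  have hG : Measurable (fun h : (_ : Finset.Iic 0) → WalkState α =>
      F (h ⟨0, Finset.mem_Iic.2 le_rfl⟩)) := hF.comp (measurable_pi_apply _)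
  rw [← lintegral_map (μ := H.walkLaw v) hG (by fun_prop), key,
    lintegral_map hG (by fun_prop)]
  rfl

/-- The Markov property at time `N`. -/
theorem lintegral_walkLaw_succ (H : Hypergraph α) (v : α) (N : ℕ)
    (A : ((_ : Finset.Iic N) → WalkState α) → ℝ≥0∞) (hA : Measurable A)
    (F : WalkState α → ℝ≥0∞) :
    ∫⁻ ω, A (Preorder.frestrictLe N ω) * F (ω (N + 1)) ∂(H.walkLaw v) =
      ∫⁻ ω, A (Preorder.frestrictLe N ω) * ∫⁻ s, F s ∂(H.step (ω N)).toMeasure ∂(H.walkLaw v) := by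
  have hF : Measurable F := Measurable.of_discrete
  have : IsProbabilityMeasure (H.arrive v).toMeasure :=
    PMF.toMeasure.isProbabilityMeasure _
  have key := Kernel.map_frestrictLe_trajMeasure_compProd_eq_map_trajMeasure
    (X := fun _ => WalkState α) (μ₀ := (H.arrive v).toMeasure) (κ := H.pastKernel) (a := N)
  change (H.walkLaw v).map _ ⊗ₘ _ = (H.walkLaw v).map _ at key
  have hG : Measurable (fun q : ((_ : Finset.Iic N) → WalkState α) × WalkState α =>
      A q.1 * F q.2) := by fun_prop
  have h1 := lintegral_map (μ := H.walkLaw v) hG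
    (g := fun ω => (Preorder.frestrictLe N ω, ω (N + 1))) (by fun_prop)
  rw [← h1, ← key, Measure.lintegral_compProd hG]
  have hS : Measurable (fun s : WalkState α => ∫⁻ s', F s' ∂(H.step s).toMeasure) :=
    Measurable.of_discrete
  have h2 : ∀ h : (_ : Finset.Iic N) → WalkState α,
      ∫⁻ s, A h * F s ∂(H.pastKernel N h) =
        A h * ∫⁻ s, F s ∂(H.step (h ⟨N, Finset.mem_Iic.2 le_rfl⟩)).toMeasure := by
    intro h
    rw [lintegral_const_mul _ hF]
    rfl
  simp_rw [h2]
  have h3 : Measurable (fun h : (_ : Finset.Iic N) → WalkState α =>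
      A h * ∫⁻ s, F s ∂(H.step (h ⟨N, Finset.mem_Iic.2 le_rfl⟩)).toMeasure) :=
    hA.mul (hS.comp (measurable_pi_apply _))
  rw [lintegral_map h3 (by fun_prop)]
  rfl

/-- A bounded function of the state that is dominated by one plus its mean after one step, and
that vanishes once `u` hears the walk, bounds the radio hitting time of `u` from below. -/
theorem lintegral_arrive_le_radioHittingTime (H : Hypergraph α) (v u : α)
    (F : WalkState α → ℝ≥0∞) (M : ℝ≥0) (hM : ∀ s, F s ≤ M) (h0 : ∀ s, u ∈ s.edge → F s = 0)
    (hF : ∀ s, u ∉ s.edge → F s ≤ 1 + ∫⁻ s', F s' ∂(H.step s).toMeasure) :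
    ∫⁻ s, F s ∂(H.arrive v).toMeasure ≤ H.radioHittingTime v u := by
  classical
  -- `P N` is the probability of not being heard up to time `N`, and `b N` is the mean of `F` on
  -- that event. The inequality `b N ≤ P N + b (N + 1)` telescopes.
  set P : ℕ → ℝ≥0∞ := fun N => ∫⁻ ω, (unheard u N).indicator 1 ω ∂(H.walkLaw v)
  set b : ℕ → ℝ≥0∞ := fun N =>
    ∫⁻ ω, (unheard u N).indicator 1 ω * F (ω N) ∂(H.walkLaw v)
  have hind : ∀ N, Measurable ((unheard u N).indicator (1 : (ℕ → WalkState α) → ℝ≥0∞)) :=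
    fun N => measurable_one.indicator (measurableSet_unheard u N)
  have hb0 : ∫⁻ s, F s ∂(H.arrive v).toMeasure ≤ b 0 := by
    rw [← lintegral_walkLaw_zero]
    refine lintegral_mono fun ω => ?_
    by_cases h : u ∈ (ω 0).edge
    · simp [h0 _ h]
    · have : ω ∈ unheard u 0 := fun t ht => by rwa [Nat.le_zero.1 ht]
      simp [this]
  have hstep : ∀ N, b N ≤ P N + b (N + 1) := by
    intro N
    set A : ((_ : Finset.Iic N) → WalkState α) → ℝ≥0∞ :=
      Set.indicator {h | ∀ i, u ∉ (h i).edge} 1 with hA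
    have hAmeas : Measurable A := by
      refine measurable_one.indicator ?_
      have : {h : (_ : Finset.Iic N) → WalkState α | ∀ i, u ∉ (h i).edge} =
          ⋂ i, (fun h => h i) ⁻¹' {s | u ∉ s.edge} := by
        ext; simp
      rw [this]
      exact MeasurableSet.iInter fun t => measurable_pi_apply t (MeasurableSet.of_discrete)
    have hAu : ∀ ω, (unheard u N).indicator (1 : (ℕ → WalkState α) → ℝ≥0∞) ω =
        A (Preorder.frestrictLe N ω) := by
      intro ω
      simp only [hA, Set.indicator_apply]
      congr 1
      simp [unheard]
    have hsucc : b (N + 1) = ∫⁻ ω, A (Preorder.frestrictLe N ω) * F (ω (N + 1)) ∂(H.walkLaw v) := by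
      refine lintegral_congr fun ω => ?_
      by_cases h : u ∈ (ω (N + 1)).edge
      -- The event for time `N + 1` may be replaced by the one for time `N`, because `F` vanishes
      -- where they differ.
      · simp [h0 _ h]
      · rw [← hAu]
        congr 1
        simp only [Set.indicator_apply]
        congr 1
        refine propext ⟨fun hω t ht => hω t (by omega), fun hω t ht => ?_⟩
        rcases Nat.le_succ_iff.1 ht with ht | rfl
        · exact hω t ht
        · exact h
    rw [hsucc, lintegral_walkLaw_succ _ _ _ _ hAmeas, ← lintegral_add_left (hind N)]
    refine lintegral_mono fun ω => ?_
    rw [← hAu]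
    by_cases h : ω ∈ unheard u N
    · simpa [h] using hF _ (h N le_rfl)
    · simp [h]
  have hsum : ∀ N, b 0 ≤ ∑ t ∈ Finset.range N, P t + b N := by
    intro N
    induction N with
    | zero => simp
    | succ N ih =>
      rw [Finset.sum_range_succ, add_assoc]
      exact ih.trans (by gcongr; exact hstep N)
  have hP : ∀ N, ∑ t ∈ Finset.range N, P t ≤ H.radioHittingTime v u := by
    intro N
    rw [← lintegral_finsetSum _ fun t _ => hind t]
    exact lintegral_mono fun ω => sum_indicator_unheard_le u N ω
  have hbM : ∀ N, b N ≤ M * P N := by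
    intro N
    rw [← lintegral_const_mul _ (hind N)]
    refine lintegral_mono fun ω => ?_
    rw [mul_comm]
    gcongr
    exact hM _
  have hNP : ∀ N : ℕ, N * P N ≤ H.radioHittingTime v u := by
    intro N
    rw [← lintegral_const_mul _ (hind N)]
    exact lintegral_mono fun ω => mul_indicator_unheard_le u N ω
  generalize H.radioHittingTime v u = T at hP hNP ⊢
  refine hb0.trans ?_
  rcases eq_or_ne T ⊤ with hT | hT
  · rw [hT]; exact le_top
  -- The remainder satisfies `b N ≤ M * P N ≤ M * T / N`. Multiplying by `N` avoids the division;
  -- large `N` then forces `b 0 ≤ T`.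
  have hlin : ∀ N : ℕ, (N : ℝ≥0∞) * b 0 ≤ N * T + M * T := by
    intro N
    calc (N : ℝ≥0∞) * b 0 ≤ N * (T + M * P N) := by
          gcongr
          exact (hsum N).trans (add_le_add (hP N) (hbM N))
      _ = N * T + M * (N * P N) := by ring
      _ ≤ N * T + M * T := by gcongr; exact hNP N
  have hbtop : b 0 ≠ ⊤ := by
    have := hlin 1
    rw [Nat.cast_one, one_mul] at this
    exact ne_top_of_le_ne_top (by finiteness) this
  lift T to ℝ≥0 using hT
  generalize b 0 = B at hlin hbtop ⊢
  lift B to ℝ≥0 using hbtop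
  have hlin' : ∀ N : ℕ, (N : ℝ) * B ≤ N * T + M * T := fun N => by exact_mod_cast hlin N
  by_contra hlt
  have hlt' : (T : ℝ) < B := by
    rw [not_le] at hlt
    exact_mod_cast hlt
  obtain ⟨N, hN⟩ := exists_nat_gt ((M * T : ℝ) / (B - T))
  rw [div_lt_iff₀ (by linarith)] at hN
  linarith [hlin' N]

/-- If no vertex is isolated, then almost surely each edge contains the vertex from which it is
chosen. -/
theorem ae_vertex_mem_edge (H : Hypergraph α) (hH : ∀ x, (H.edgesAt x).Nonempty) (v : α) :
    ∀ᵐ ω ∂(H.walkLaw v), ∀ t, (ω t).vertex ∈ (ω t).edge := by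
  classical
  have harrive : ∀ x, ∫⁻ s, {s : WalkState α | s.vertex ∉ s.edge}.indicator 1 s
      ∂(H.arrive x).toMeasure = 0 := by
    intro x
    rw [lintegral_arrive, ENNReal.tsum_eq_zero]
    intro e
    rw [uniformOr, dif_pos (hH x)]
    by_cases he : e ∈ H.edgesAt x
    · have : x ∈ e := he.2
      simp [this]
    · rw [PMF.uniformOfFinset_apply_of_notMem _ (by simpa using he), zero_mul]
  have hzero : ∀ t, ∫⁻ ω, {s : WalkState α | s.vertex ∉ s.edge}.indicator 1 (ω t)
      ∂(H.walkLaw v) = 0 := by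
    intro t
    cases t with
    | zero => rw [lintegral_walkLaw_zero, harrive]
    | succ N =>
      have := lintegral_walkLaw_succ H v N (fun _ => 1) measurable_const
        ({s : WalkState α | s.vertex ∉ s.edge}.indicator 1)
      simp only [one_mul] at this
      rw [this]
      simp only [lintegral_step, harrive, mul_zero, tsum_zero, lintegral_zero]
  rw [ae_all_iff]
  intro t
  have hmeas : Measurable (fun ω : ℕ → WalkState α =>
      {s : WalkState α | s.vertex ∉ s.edge}.indicator (1 : WalkState α → ℝ≥0∞) (ω t)) :=
    (Measurable.of_discrete (f := {s : WalkState α | s.vertex ∉ s.edge}.indicator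
      (1 : WalkState α → ℝ≥0∞))).comp (measurable_pi_apply t)
  filter_upwards [(lintegral_eq_zero_iff hmeas).1 (hzero t)] with ω hω
  by_contra h
  simp [h] at hω

/-- Almost surely `X(t) ∈ e(t)`, so `u` hears the walk no later than it is visited. At an isolated
vertex this would fail, since the edge used there is empty. -/
theorem radioCoverTime_le_coverTime (H : Hypergraph α) (hH : ∀ x, (H.edgesAt x).Nonempty) :
    H.radioCoverTime ≤ H.coverTime := by
  refine iSup₂_mono fun v _ => lintegral_mono_ae ?_
  filter_upwards [ae_vertex_mem_edge H hH v] with ω hω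
  refine iSup₂_mono fun u _ => le_iInf₂ fun t ht => iInf₂_le t ?_
  rw [← ht]
  exact hω t

theorem maxRadioHittingTime_le_radioCoverTime (H : Hypergraph α) :
    H.maxRadioHittingTime ≤ H.radioCoverTime :=
  iSup₂_mono fun _ _ => iSup₂_le fun u hu => lintegral_mono fun ω =>
    le_iSup₂ (f := fun u (_ : u ∈ H.vertexSet) => hearTime u ω) u hu

open Classical in
/-- A nonnegative function `g` on the vertices that is dominated by the mean, over a random edge at
each vertex, of the remaining time bounds the radio hitting time of `u` from below. -/
theorem le_radioHittingTime (H : Hypergraph α) (u : α) (E : α → Finset (Finset α))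
    (hE : ∀ x, H.edgesAt x = (fun e : Finset α => (e : Set α)) '' (E x))
    (hne : ∀ x, (E x).Nonempty) (g : α → ℝ) (hg0 : ∀ x, 0 ≤ g x)
    (hg : ∀ x, (E x).card * g x ≤
      ∑ e ∈ E x, if u ∈ e then 0 else 1 + (∑ y ∈ e, g y) / e.card) (v : α) :
    ENNReal.ofReal (g v) ≤ H.radioHittingTime v u := by
  -- `F` is the expected remaining time predicted by `g` once the current edge is known; averaging
  -- it over that edge recovers the hypothesis on `g`.
  have := Fintype.ofFinite α
  set F : WalkState α → ℝ≥0∞ := fun s => if u ∈ s.edge then 0 else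
    1 + ∑' y, uniformOr s.edge s.vertex y * ENNReal.ofReal (g y) with hFdef
  have hmem : ∀ x, ∀ e ∈ E x, x ∈ e := by
    intro x e he
    have : (e : Set α) ∈ H.edgesAt x := by rw [hE]; exact ⟨e, he, rfl⟩
    exact_mod_cast this.2
  have harr : ∀ x, ENNReal.ofReal (g x) ≤ ∫⁻ s, F s ∂(H.arrive x).toMeasure := by
    intro x
    have hcard : 0 < ((E x).card : ℝ) := by exact_mod_cast (hne x).card_pos
    rw [lintegral_arrive, hE, tsum_uniformOr_mul _ (hne x) _ Finset.coe_injective]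
    have hFe : ∀ e ∈ E x, F ⟨x, (e : Set α)⟩ =
        ENNReal.ofReal (if u ∈ e then 0 else 1 + (∑ y ∈ e, g y) / e.card) := by
      intro e he
      have hepos : e.Nonempty := ⟨x, hmem x e he⟩
      have h1 := tsum_uniformOr_mul e hepos id Function.injective_id x
        (fun y => ENNReal.ofReal (g y))
      rw [Set.image_id] at h1
      simp only [hFdef, Finset.mem_coe, h1, id]
      split_ifs
      · simp
      · rw [ENNReal.ofReal_add zero_le_one 
            (div_nonneg (Finset.sum_nonneg fun y _ => hg0 y) (Nat.cast_nonneg _)),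
          ENNReal.ofReal_one,
          ENNReal.ofReal_div_of_pos (by exact_mod_cast hepos.card_pos),
          ENNReal.ofReal_sum_of_nonneg fun y _ => hg0 y, ENNReal.ofReal_natCast]
    rw [Finset.sum_congr rfl hFe, ← ENNReal.ofReal_sum_of_nonneg, ← ENNReal.ofReal_natCast,
      ← ENNReal.ofReal_div_of_pos hcard]
    · refine ENNReal.ofReal_le_ofReal ?_
      rw [le_div_iff₀ hcard, mul_comm]
      exact hg x
    · intro e _
      split_ifs
      · exact le_rfl
      · have := Finset.sum_nonneg fun y (_ : y ∈ e) => hg0 y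
        positivity
  obtain ⟨M, hM⟩ : ∃ M : ℝ≥0, ∀ x, ENNReal.ofReal (g x) ≤ M :=
    ⟨∑ x, (g x).toNNReal, fun x => ENNReal.coe_le_coe.2
      (Finset.single_le_sum (f := fun x => (g x).toNNReal) (fun _ _ => zero_le)
        (Finset.mem_univ x))⟩
  refine (harr v).trans
    (lintegral_arrive_le_radioHittingTime H v u F (1 + M) (fun s => ?_) (fun s hs => ?_)
      (fun s hs => ?_))
  · simp only [hFdef]
    split_ifs
    · exact zero_le
    · rw [ENNReal.coe_add, ENNReal.coe_one]
      gcongr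
      calc ∑' y, uniformOr s.edge s.vertex y * ENNReal.ofReal (g y)
          ≤ ∑' y, uniformOr s.edge s.vertex y * M := by gcongr; exact hM _
        _ = M := by rw [ENNReal.tsum_mul_right, PMF.tsum_coe, one_mul]
  · simp [hFdef, hs]
  · rw [lintegral_step]
    simp only [hFdef, hs, if_false]
    gcongr
    exact harr _

end

/-! ### The clique glued to the line: edges, incidences and counts. -/

section CliqueLine

variable (q ℓ c : ℕ)

/-- The vertices of the clique. -/
def cliqueVerts : Finset (Fin (q + ℓ + 1)) := Finset.univ.filter (fun x => x.val ≤ q)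

/-- The vertices of the line. -/
def linePoint (j : Fin (ℓ + 1)) : Fin (q + ℓ + 1) := ⟨q + j.val, by omega⟩

/-- The edges of the line. -/
def linePair (i : Fin ℓ) : Finset (Fin (q + ℓ + 1)) :=
  {linePoint q ℓ i.castSucc, linePoint q ℓ i.succ}

/-- All edges of the clique and of the line. -/
def cliqueLineEdges : Finset (Finset (Fin (q + ℓ + 1))) :=
  (cliqueVerts q ℓ).powersetCard c ∪ Finset.univ.image (linePair q ℓ)

/-- The `c`-uniform clique on the vertices `0, …, q` glued at `q` to the line `q, …, q + ℓ`. -/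
def cliqueLine : Hypergraph (Fin (q + ℓ + 1)) where
  vertexSet := Set.univ
  edgeSet := (fun e : Finset (Fin (q + ℓ + 1)) => (e : Set (Fin (q + ℓ + 1)))) ''
    cliqueLineEdges q ℓ c
  subset_vertexSet_of_mem_edgeSet' := fun _ _ => Set.subset_univ _

variable {q ℓ c}

theorem mem_cliqueVerts {x : Fin (q + ℓ + 1)} : x ∈ cliqueVerts q ℓ ↔ x.val ≤ q := by
  simp [cliqueVerts]

theorem card_cliqueVerts : (cliqueVerts q ℓ).card = q + 1 := by
  have : (cliqueVerts q ℓ).map Fin.valEmbedding = Finset.range (q + 1) := by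
    ext x
    simp only [Finset.mem_map, mem_cliqueVerts, Fin.valEmbedding_apply, Finset.mem_range]
    exact ⟨by rintro ⟨y, hy, rfl⟩; omega, fun hx => ⟨⟨x, by omega⟩, by simp; omega, rfl⟩⟩
  rw [← Finset.card_map Fin.valEmbedding, this, Finset.card_range]

theorem mem_linePair {i : Fin ℓ} {x : Fin (q + ℓ + 1)} :
    x ∈ linePair q ℓ i ↔ x.val = q + i.val ∨ x.val = q + i.val + 1 := by
  simp [linePair, linePoint, Fin.ext_iff, add_assoc]

theorem linePair_injective : Function.Injective (linePair q ℓ) := by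
  intro i j h
  have h1 : linePoint q ℓ i.castSucc ∈ linePair q ℓ j := by rw [← h]; simp [linePair]
  have h2 : linePoint q ℓ j.castSucc ∈ linePair q ℓ i := by rw [h]; simp [linePair]
  rw [mem_linePair] at h1 h2
  simp only [linePoint, Fin.val_castSucc] at h1 h2
  ext
  omega

theorem card_linePair (i : Fin ℓ) : (linePair q ℓ i).card = 2 :=
  Finset.card_pair (by simp [linePoint, Fin.ext_iff])

/-- This keeps line edges distinct from clique edges even for `c = 2`, when both have two elements.
-/
theorem not_linePair_subset (i : Fin ℓ) : ¬ linePair q ℓ i ⊆ cliqueVerts q ℓ := by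
  intro h
  have := mem_cliqueVerts.1 (h (show linePoint q ℓ i.succ ∈ _ by simp [linePair]))
  simp [linePoint] at this

theorem mem_cliqueLineEdges {e : Finset (Fin (q + ℓ + 1))} :
    e ∈ cliqueLineEdges q ℓ c ↔
      (e ⊆ cliqueVerts q ℓ ∧ e.card = c) ∨ ∃ i, linePair q ℓ i = e := by
  simp [cliqueLineEdges]

variable (q ℓ c) in
/-- The edges of the clique that contain `x`. -/
def cliqueAt (x : Fin (q + ℓ + 1)) : Finset (Finset (Fin (q + ℓ + 1))) :=
  ((cliqueVerts q ℓ).powersetCard c).filter (x ∈ ·)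

variable (q ℓ) in
/-- The indices of the edges of the line that contain `x`. -/
def lineAt (x : Fin (q + ℓ + 1)) : Finset (Fin ℓ) := Finset.univ.filter (x ∈ linePair q ℓ ·)

theorem sum_edgesAt (x : Fin (q + ℓ + 1)) (Φ : Finset (Fin (q + ℓ + 1)) → ℝ) :
    ∑ e ∈ (cliqueLineEdges q ℓ c).filter (x ∈ ·), Φ e =
      ∑ e ∈ cliqueAt q ℓ c x, Φ e + ∑ i ∈ lineAt q ℓ x, Φ (linePair q ℓ i) := by
  classical
  have : (cliqueLineEdges q ℓ c).filter (x ∈ ·) =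
      cliqueAt q ℓ c x ∪ (lineAt q ℓ x).image (linePair q ℓ) := by
    ext e
    simp only [Finset.mem_filter, mem_cliqueLineEdges, cliqueAt, lineAt, Finset.mem_union,
      Finset.mem_image, Finset.mem_powersetCard, Finset.mem_univ, true_and]
    constructor
    · rintro ⟨h | ⟨i, rfl⟩, hx⟩
      · exact Or.inl ⟨h, hx⟩
      · exact Or.inr ⟨i, hx, rfl⟩
    · rintro (⟨h, hx⟩ | ⟨i, hx, rfl⟩)
      · exact ⟨Or.inl h, hx⟩
      · exact ⟨Or.inr ⟨i, rfl⟩, hx⟩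
  rw [this, Finset.sum_union, Finset.sum_image fun i _ j _ h => linePair_injective h]
  rw [Finset.disjoint_left]
  intro e he he'
  obtain ⟨i, -, rfl⟩ := Finset.mem_image.1 he'
  exact not_linePair_subset i (Finset.mem_powersetCard.1 (Finset.mem_filter.1 he).1).1

theorem card_edgesAt (x : Fin (q + ℓ + 1)) :
    (((cliqueLineEdges q ℓ c).filter (x ∈ ·)).card : ℝ) =
      (cliqueAt q ℓ c x).card + (lineAt q ℓ x).card := by
  have := sum_edgesAt (c := c) x (fun _ => 1)
  simpa using this

theorem lineAt_of_lt {x : Fin (q + ℓ + 1)} (hx : x.val < q) : lineAt q ℓ x = ∅ := by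
  ext i
  simp only [lineAt, Finset.mem_filter, mem_linePair, Finset.mem_univ, true_and,
    Finset.notMem_empty, iff_false]
  omega

theorem lineAt_of_eq (hℓ : 0 < ℓ) {x : Fin (q + ℓ + 1)} (hx : x.val = q) :
    lineAt q ℓ x = {⟨0, hℓ⟩} := by
  ext i
  simp only [lineAt, Finset.mem_filter, mem_linePair, Finset.mem_univ, true_and,
    Finset.mem_singleton, Fin.ext_iff]
  omega

theorem lineAt_of_gt {x : Fin (q + ℓ + 1)} (hx : q < x.val) (hx' : x.val < q + ℓ) :
    lineAt q ℓ x = {⟨x.val - q - 1, by omega⟩, ⟨x.val - q, by omega⟩} := by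
  ext i
  simp only [lineAt, Finset.mem_filter, mem_linePair, Finset.mem_univ, true_and,
    Finset.mem_singleton, Finset.mem_insert, Fin.ext_iff]
  omega

theorem cliqueAt_of_gt {x : Fin (q + ℓ + 1)} (hx : q < x.val) : cliqueAt q ℓ c x = ∅ := by
  ext e
  simp only [cliqueAt, Finset.mem_filter, Finset.mem_powersetCard, Finset.notMem_empty, iff_false]
  rintro ⟨⟨h, -⟩, hxe⟩
  exact absurd (mem_cliqueVerts.1 (h hxe)) (by omega)

theorem card_cliqueAt {x : Fin (q + ℓ + 1)} (hx : x.val ≤ q) (hc : 1 ≤ c) :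
    (cliqueAt q ℓ c x).card = q.choose (c - 1) := by
  have := Finset.card_filter_powersetCard_subset {x} (cliqueVerts q ℓ) c
    (by simpa using mem_cliqueVerts.2 hx) (by simpa using hc)
  rw [card_cliqueVerts] at this
  simpa [cliqueAt] using this

theorem card_cliqueAt_filter {x y : Fin (q + ℓ + 1)} (hxy : x ≠ y) (hx : x.val ≤ q)
    (hy : y.val ≤ q) (hc : 2 ≤ c) :
    ((cliqueAt q ℓ c x).filter (y ∈ ·)).card = (q - 1).choose (c - 2) := by
  have := Finset.card_filter_powersetCard_subset {x, y} (cliqueVerts q ℓ) c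
    (by simp [Finset.insert_subset_iff, mem_cliqueVerts, hx, hy])
    (by rwa [Finset.card_pair hxy])
  rw [card_cliqueVerts, Finset.card_pair hxy] at this
  rw [cliqueAt, Finset.filter_filter]
  simpa [Finset.insert_subset_iff] using this

/-- It shows that the line edges at most double the number of clique edges. -/
theorem le_choose_of_lt {m k : ℕ} (h1 : 1 ≤ k) (h2 : k < m) : m ≤ m.choose k := by
  induction m with
  | zero => omega
  | succ m ih =>
    rcases Nat.lt_succ_iff_lt_or_eq.1 h2 with h | rfl
    · obtain ⟨k, rfl⟩ := Nat.exists_eq_add_of_le' h1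
      rw [Nat.choose_succ_succ']
      have := ih h
      have := Nat.choose_pos (show k ≤ m by omega)
      omega
    · simp

theorem exists_cliqueEdge (hc : 2 ≤ c) (hcq : c ≤ q) {x y : Fin (q + ℓ + 1)} (hx : x.val ≤ q)
    (hy : y.val ≤ q) : ∃ e ∈ cliqueLineEdges q ℓ c, e ⊆ cliqueVerts q ℓ ∧ x ∈ e ∧ y ∈ e := by
  obtain ⟨e, h1, h2, h3⟩ := Finset.exists_subsuperset_card_eq (s := {x, y})
    (t := cliqueVerts q ℓ) (n := c)
    (by simp [Finset.insert_subset_iff, mem_cliqueVerts, hx, hy])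
    (Finset.card_le_two.trans hc) (by rw [card_cliqueVerts]; omega)
  rw [Finset.insert_subset_iff, Finset.singleton_subset_iff] at h1
  exact ⟨e, mem_cliqueLineEdges.2 (Or.inl ⟨h2, h3⟩), h2, h1⟩

/-! ### Structure of the glued hyper-graph: shape, connectivity, rank, size. -/

theorem isCliqueLineGluing_cliqueLine : (cliqueLine q ℓ c).IsCliqueLineGluing c (q + 1) := by
  refine ⟨cliqueVerts q ℓ, ℓ, linePoint q ℓ, ?_, ?_, ?_, ?_, ?_⟩
  · rw [Set.encard_coe_eq_coe_finsetCard, card_cliqueVerts]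
  · intro i j h
    simpa [linePoint, Fin.ext_iff] using h
  · ext x
    simp only [Set.mem_inter_iff, Finset.mem_coe, mem_cliqueVerts, Set.mem_range,
      Set.mem_singleton_iff]
    constructor
    · rintro ⟨h, j, rfl⟩
      simp only [linePoint, Fin.ext_iff, Fin.val_zero] at h ⊢
      omega
    · rintro rfl
      exact ⟨by simp [linePoint], 0, rfl⟩
  · refine (Set.eq_univ_of_forall fun x => ?_).symm
    rcases le_or_gt x.val q with h | h
    · exact Or.inl (mem_cliqueVerts.2 h)
    · exact Or.inr ⟨⟨x.val - q, by omega⟩, by simp only [linePoint, Fin.ext_iff]; omega⟩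
  · ext e
    simp only [cliqueLine, Set.mem_image, Finset.mem_coe, mem_cliqueLineEdges, Set.mem_union,
      Set.mem_ofPred_eq, Set.mem_range]
    constructor
    · rintro ⟨e, ⟨h, h'⟩ | ⟨i, rfl⟩, rfl⟩
      · exact Or.inl ⟨by exact_mod_cast h, by rw [Set.encard_coe_eq_coe_finsetCard, h']⟩
      · exact Or.inr ⟨i, by simp [linePair]⟩
    · rintro (⟨h, h'⟩ | ⟨i, rfl⟩)
      · refine ⟨e.toFinite.toFinset, Or.inl ⟨by simpa using h, ?_⟩, by simp⟩
        rw [(Set.toFinite e).encard_eq_coe_toFinset_card] at h'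
        exact_mod_cast h'
      · exact ⟨_, Or.inr ⟨i, rfl⟩, by simp [linePair]⟩

theorem cliqueLine_adj_of_mem {e : Finset (Fin (q + ℓ + 1))} (he : e ∈ cliqueLineEdges q ℓ c)
    {x y : Fin (q + ℓ + 1)} (hx : x ∈ e) (hy : y ∈ e) : (cliqueLine q ℓ c).Adj x y :=
  ⟨e, ⟨e, he, rfl⟩, hx, hy⟩

theorem connected_cliqueLine (hc : 2 ≤ c) (hcq : c ≤ q) : (cliqueLine q ℓ c).Connected := by
  have hto : ∀ k (x : Fin (q + ℓ + 1)), x.val = k →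
      Relation.ReflTransGen (cliqueLine q ℓ c).Adj x (linePoint q ℓ 0) := by
    intro k
    induction k with
    | zero =>
      intro x hx
      obtain ⟨e, he, -, hxe, hye⟩ := exists_cliqueEdge (ℓ := ℓ) hc hcq (x := x)
        (y := linePoint q ℓ 0) (by omega) (by simp [linePoint])
      exact .single (cliqueLine_adj_of_mem he hxe hye)
    | succ k ih =>
      intro x hx
      rcases le_or_gt x.val q with h | h
      · obtain ⟨e, he, -, hxe, hye⟩ := exists_cliqueEdge (ℓ := ℓ) hc hcq h
          (y := linePoint q ℓ 0) (by simp [linePoint])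
        exact .single (cliqueLine_adj_of_mem he hxe hye)
      · refine .head (b := ⟨k, by omega⟩) ?_ (ih _ rfl)
        refine cliqueLine_adj_of_mem
          (mem_cliqueLineEdges.2 (Or.inr ⟨⟨k - q, by omega⟩, rfl⟩)) ?_ ?_ <;>
        · simp only [mem_linePair]
          omega
  have : Std.Symm (cliqueLine q ℓ c).Adj := ⟨fun _ _ h => h.symm⟩
  exact ⟨⟨linePoint q ℓ 0, trivial⟩, fun u _ v _ => (hto _ u rfl).trans
    (Std.Symm.symm _ _ (hto _ v rfl))⟩

theorem rank_cliqueLine (hc : 2 ≤ c) (hcq : c ≤ q) : (cliqueLine q ℓ c).rank = c := by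
  refine le_antisymm (iSup₂_le ?_) ?_
  · rintro _ ⟨e, he, rfl⟩
    rw [Set.encard_coe_eq_coe_finsetCard]
    rcases mem_cliqueLineEdges.1 he with ⟨-, h⟩ | ⟨i, rfl⟩
    · rw [h]
    · rw [card_linePair]
      exact_mod_cast hc
  · obtain ⟨e, h2, h3⟩ := Finset.exists_subset_card_eq (s := cliqueVerts q ℓ) (n := c)
      (by rw [card_cliqueVerts]; omega)
    refine le_trans ?_ (le_iSup₂ (f := fun e (_ : e ∈ (cliqueLine q ℓ c).edgeSet) => e.encard)
      (e : Set (Fin (q + ℓ + 1))) ⟨e, mem_cliqueLineEdges.2 (Or.inl ⟨h2, h3⟩), rfl⟩)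
    rw [Set.encard_coe_eq_coe_finsetCard, h3]

theorem ncard_edgeSet_cliqueLine_le :
    (cliqueLine q ℓ c).edgeSet.ncard ≤ (q + 1).choose c + ℓ := by
  have : (cliqueLine q ℓ c).edgeSet.ncard = (cliqueLineEdges q ℓ c).card := by
    rw [cliqueLine, Set.ncard_image_of_injective _ Finset.coe_injective, Set.ncard_coe_finset]
  rw [this]
  refine (Finset.card_union_le _ _).trans (add_le_add ?_ ?_)
  · rw [Finset.card_powersetCard, card_cliqueVerts]
  · exact Finset.card_image_le.trans (by simp)

theorem edgesAt_cliqueLine (x : Fin (q + ℓ + 1)) :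
    (cliqueLine q ℓ c).edgesAt x =
      (fun e : Finset (Fin (q + ℓ + 1)) => (e : Set (Fin (q + ℓ + 1)))) ''
        ((cliqueLineEdges q ℓ c).filter (x ∈ ·)) := by
  ext e
  simp only [edgesAt, cliqueLine, Set.mem_ofPred_eq, Set.mem_image, Finset.coe_filter,
    Finset.mem_coe]
  constructor
  · rintro ⟨⟨e, he, rfl⟩, hx⟩
    exact ⟨e, ⟨he, hx⟩, rfl⟩
  · rintro ⟨e, ⟨he, hx⟩, rfl⟩
    exact ⟨⟨e, he, rfl⟩, hx⟩

theorem edgesAt_cliqueLine_nonempty (hc : 2 ≤ c) (hcq : c ≤ q) (x : Fin (q + ℓ + 1)) :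
    ((cliqueLineEdges q ℓ c).filter (x ∈ ·)).Nonempty := by
  rcases le_or_gt x.val q with h | h
  · obtain ⟨e, he, -, hx, -⟩ := exists_cliqueEdge (ℓ := ℓ) hc hcq h h
    exact ⟨e, Finset.mem_filter.2 ⟨he, hx⟩⟩
  · refine ⟨linePair q ℓ ⟨x.val - q - 1, by omega⟩, Finset.mem_filter.2
      ⟨mem_cliqueLineEdges.2 (Or.inr ⟨_, rfl⟩), ?_⟩⟩
    simp only [mem_linePair]
    omega

/-! ### The potential and the lower bound for the hitting time. -/

/-- A lower bound for the radio hitting time of the end of the line, as a function of the start: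
it is linear along the line and constant on the rest of the clique. -/
noncomputable def potential (q ℓ c k : ℕ) : ℝ :=
  if k < q then q.choose (c - 1) * (q + 1) * (2 * ℓ - 1) + c * q / (c - 1)
  -- The `- 1` makes the linear function, extended to the end of the line, have mean `0` on the last
  -- edge, where the target already hears the walk. The value at the end itself is reset to `0` to
  -- keep the potential nonnegative.
  else if k < q + ℓ then q.choose (c - 1) * (q + 1) * (2 * (q + ℓ - k) - 1)
  else 0

theorem potential_nonneg (hc : 2 ≤ c) (hℓ : 1 ≤ ℓ) (k : ℕ) : 0 ≤ potential q ℓ c k := by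
  have hc' : (2 : ℝ) ≤ c := by exact_mod_cast hc
  have hℓ' : (1 : ℝ) ≤ ℓ := by exact_mod_cast hℓ
  unfold potential
  split_ifs with h1 h2
  · have : (0 : ℝ) ≤ 2 * ℓ - 1 := by linarith
    have : (0 : ℝ) ≤ (c : ℝ) - 1 := by linarith
    positivity
  · have : (k : ℝ) + 1 ≤ q + ℓ := by exact_mod_cast h2
    have : (0 : ℝ) ≤ 2 * (q + ℓ - k) - 1 := by linarith
    positivity
  · exact le_rfl

theorem sum_potential (hℓ : 1 ≤ ℓ) {e : Finset (Fin (q + ℓ + 1))} (he : e ⊆ cliqueVerts q ℓ) :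
    ∑ y ∈ e, potential q ℓ c y.val =
      e.card * (potential q ℓ c q + c * q / (c - 1)) -
        if linePoint q ℓ 0 ∈ e then (c * q / (c - 1) : ℝ) else 0 := by
  have h : ∀ y ∈ e, potential q ℓ c y.val = (potential q ℓ c q + c * q / (c - 1)) -
      if y = linePoint q ℓ 0 then (c * q / (c - 1) : ℝ) else 0 := by
    intro y hy
    have hy' := mem_cliqueVerts.1 (he hy)
    by_cases h : y = linePoint q ℓ 0
    · subst h
      simp [linePoint]
    · have hlt : y.val < q := by
        refine lt_of_le_of_ne hy' fun h' => h ?_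
        ext
        simpa [linePoint] using h'
      have : q < q + ℓ := by omega
      simp [h, potential, hlt, this]
  rw [Finset.sum_congr rfl h, Finset.sum_sub_distrib, Finset.sum_const, nsmul_eq_mul,
    Finset.sum_ite_eq' e]

theorem sum_linePair (i : Fin ℓ) (g : ℕ → ℝ) :
    ∑ y ∈ linePair q ℓ i, g y.val = g (q + i.val) + g (q + i.val + 1) := by
  rw [linePair, Finset.sum_pair (by simp [linePoint, Fin.ext_iff])]
  simp [linePoint, add_assoc]

/-- The contribution of the edges of the clique at `x` in the superharmonic inequality. -/
theorem sum_cliqueAt (hc : 2 ≤ c) (hcq : c ≤ q) (hℓ : 1 ≤ ℓ) {x : Fin (q + ℓ + 1)}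
    (hx : x.val ≤ q) :
    (∑ e ∈ cliqueAt q ℓ c x, if Fin.last (q + ℓ) ∈ e then (0 : ℝ)
        else 1 + (∑ y ∈ e, potential q ℓ c y.val) / e.card) =
      q.choose (c - 1) * potential q ℓ c x.val +
        if x.val = q then (q.choose (c - 1) * (q + 1) : ℝ) else 0 := by
  obtain ⟨k, rfl⟩ := Nat.exists_eq_add_of_le' hc
  obtain ⟨r, rfl⟩ := Nat.exists_eq_add_of_le' (show 1 ≤ q by omega)
  have hterm : ∀ e ∈ cliqueAt (r + 1) ℓ (k + 2) x,
      (if Fin.last (r + 1 + ℓ) ∈ e then (0 : ℝ)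
        else 1 + (∑ y ∈ e, potential (r + 1) ℓ (k + 2) y.val) / e.card) =
      -- The mean over a clique edge drops by `q / (c - 1)` exactly when the edge contains the glue
      -- vertex.
      (1 + potential (r + 1) ℓ (k + 2) (r + 1) + (k + 2) * (r + 1) / (k + 1)) -
        if linePoint (r + 1) ℓ 0 ∈ e then ((r + 1) / (k + 1) : ℝ) else 0 := by
    intro e he
    obtain ⟨h1, h2⟩ := Finset.mem_powersetCard.1 (Finset.mem_filter.1 he).1
    rw [if_neg, sum_potential hℓ h1, h2]
    · push_cast
      have e1 : (k : ℝ) + 2 - 1 = k + 1 := by ring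
      rw [e1]
      split_ifs <;> field_simp <;> ring
    · intro h
      have := mem_cliqueVerts.1 (h1 h)
      simp only [Fin.val_last] at this
      omega
  rw [Finset.sum_congr rfl hterm, Finset.sum_sub_distrib, Finset.sum_const, nsmul_eq_mul,
    ← Finset.sum_filter, Finset.sum_const, nsmul_eq_mul, card_cliqueAt hx (by omega)]
  by_cases hxq : x.val = r + 1
  · have hx0 : x = linePoint (r + 1) ℓ 0 := by ext; simpa [linePoint] using hxq
    have : (cliqueAt (r + 1) ℓ (k + 2) x).filter (linePoint (r + 1) ℓ 0 ∈ ·) =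
        cliqueAt (r + 1) ℓ (k + 2) x := by
      rw [← hx0]
      exact Finset.filter_true_of_mem fun e he => (Finset.mem_filter.1 he).2
    rw [this, card_cliqueAt hx (by omega), if_pos hxq, hxq]
    push_cast
    field_simp
    ring
  · have hx0 : x ≠ linePoint (r + 1) ℓ 0 := fun h => hxq (by rw [h]; simp [linePoint])
    rw [card_cliqueAt_filter hx0 hx (by simp [linePoint]) (by omega), if_neg hxq]
    have hlt : x.val < r + 1 := lt_of_le_of_ne hx hxq
    -- A fraction `(c - 1) / q` of the clique edges at `x` contain the glue vertex, so the average
    -- drop is `1` and cancels the unit of time.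
    have hch : ((r : ℝ) + 1) * r.choose k = (r + 1).choose (k + 1) * (k + 1) := by
      exact_mod_cast Nat.add_one_mul_choose_eq r k
    have hpot : potential (r + 1) ℓ (k + 2) x.val =
        potential (r + 1) ℓ (k + 2) (r + 1) + (k + 2) * (r + 1) / (k + 1) := by
      have h1 : r + 1 < r + 1 + ℓ := by omega
      have e1 : (k : ℝ) + 2 - 1 = k + 1 := by ring
      simp [potential, hlt, h1, e1]
    rw [hpot]
    have e2 : r + 1 - 1 = r := rfl
    have e3 : k + 2 - 2 = k := rfl
    have e4 : k + 2 - 1 = k + 1 := rfl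
    rw [e2, e3, e4]
    have : (r.choose k : ℝ) * ((r + 1) / (k + 1)) = (r + 1).choose (k + 1) := by
      field_simp
      linarith
    rw [this]
    ring

theorem potential_superharmonic (hc : 2 ≤ c) (hcq : c ≤ q) (hℓ : 1 ≤ ℓ)
    (x : Fin (q + ℓ + 1)) :
    ((cliqueLineEdges q ℓ c).filter (x ∈ ·)).card * potential q ℓ c x.val ≤
      ∑ e ∈ (cliqueLineEdges q ℓ c).filter (x ∈ ·), if Fin.last (q + ℓ) ∈ e then (0 : ℝ)
        else 1 + (∑ y ∈ e, potential q ℓ c y.val) / e.card := by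
  have hR : (0 : ℝ) ≤ q.choose (c - 1) * (q + 1) := by positivity
  have hlast : ∀ i : Fin ℓ, Fin.last (q + ℓ) ∈ linePair q ℓ i ↔ i.val + 1 = ℓ := by
    intro i
    rw [mem_linePair, Fin.val_last]
    omega
  rw [card_edgesAt, sum_edgesAt]
  simp only [hlast, card_linePair, sum_linePair]
  rcases lt_trichotomy x.val q with h | h | h
  · rw [sum_cliqueAt hc hcq hℓ h.le, card_cliqueAt h.le (by omega), lineAt_of_lt h]
    simp [h.ne]
  · rw [sum_cliqueAt hc hcq hℓ h.le, card_cliqueAt h.le (by omega), lineAt_of_eq hℓ h]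
    have hq : q < q + ℓ := by omega
    simp only [h, Finset.card_singleton, Finset.sum_singleton, if_true, zero_add, add_zero]
    -- If `ℓ = 1`, the only line edge contains the target and contributes `0`, and equality holds.
    -- Otherwise that edge contributes `1 + g - R`, leaving a slack of `1`.
    split_ifs with h1
    · subst h1
      simp only [potential, lt_irrefl, hq, if_true, if_false]
      push_cast
      linarith
    · have h2 : ¬ q + 1 < q := by omega
      have h3 : q + 1 < q + ℓ := by omega
      simp only [potential, lt_irrefl, hq, h2, h3, if_true, if_false]
      push_cast
      linarith
  · rw [cliqueAt_of_gt h]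
    rcases lt_or_ge x.val (q + ℓ) with h' | h'
    · obtain ⟨j, hj⟩ := Nat.exists_eq_add_of_lt h
      rw [lineAt_of_gt h h', Finset.card_pair (by simp [Fin.ext_iff]; omega),
        Finset.sum_pair (by simp [Fin.ext_iff]; omega)]
      simp only [hj]
      have e1 : j + 1 - 1 = j := by omega
      have e2 : q + j + 1 - q = j + 1 := by omega
      have h0 : ¬ q + j < q := by omega
      have h0' : q + j < q + ℓ := by omega
      have h1 : ¬ q + j + 1 < q := by omega
      have h1' : q + j + 1 < q + ℓ := by omega
      have h3 : ¬ j + 1 = ℓ := by omega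
      have e3 : q + (j + 1) = q + j + 1 := rfl
      simp only [e1, e2, e3, if_neg h3, Finset.card_empty, Finset.sum_empty]
      -- At the neighbour of the end, the edge towards the target contributes `0`, as the linear
      -- extension predicts, without its unit of time.
      by_cases h4 : j + 1 + 1 = ℓ
      · rw [if_pos h4]
        simp only [potential, h0, h0', h1, h1', if_true, if_false]
        subst h4
        push_cast
        linarith
      · have h2' : q + j + 1 + 1 < q + ℓ := by omega
        have h2 : ¬ q + j + 1 + 1 < q := by omega
        rw [if_neg h4]
        simp only [potential, h0, h0', h1, h1', h2, h2', if_true, if_false]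
        push_cast
        linarith
    · have h1 : ¬ x.val < q := by omega
      have h2 : ¬ x.val < q + ℓ := by omega
      have h0 : potential q ℓ c x.val = 0 := by simp [potential, h1, h2]
      rw [h0, mul_zero, Finset.sum_empty, zero_add]
      refine Finset.sum_nonneg fun i _ => ?_
      have := potential_nonneg (q := q) hc hℓ (q + i.val)
      have := potential_nonneg (q := q) hc hℓ (q + i.val + 1)
      split_ifs <;> positivity

/-- Starting at the glue vertex suffices, and `(q + 1) * q.choose (c - 1) = c * (q + 1).choose c`
rewrites the potential there. -/
theorem le_maxRadioHittingTime_cliqueLine (hc : 2 ≤ c) (hcq : c ≤ q) (hℓ : 1 ≤ ℓ) :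
    ENNReal.ofReal ((q + 1).choose c * c * (2 * ℓ - 1)) ≤
      (cliqueLine q ℓ c).maxRadioHittingTime := by
  have h := le_radioHittingTime (cliqueLine q ℓ c) (Fin.last (q + ℓ))
    (fun x => (cliqueLineEdges q ℓ c).filter (x ∈ ·)) edgesAt_cliqueLine
    (edgesAt_cliqueLine_nonempty hc hcq) (fun x => potential q ℓ c x.val)
    (fun x => potential_nonneg hc hℓ _)
    (fun x => by convert potential_superharmonic hc hcq hℓ x) (linePoint q ℓ 0)
  have hpot : potential q ℓ c (linePoint q ℓ 0).val = (q + 1).choose c * c * (2 * ℓ - 1) := by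
    obtain ⟨k, rfl⟩ := Nat.exists_eq_add_of_le' (show 1 ≤ c by omega)
    have hch : ((q : ℝ) + 1) * q.choose k = (q + 1).choose (k + 1) * (k + 1) := by
      exact_mod_cast Nat.add_one_mul_choose_eq q k
    have h1 : q < q + ℓ := by omega
    simp only [linePoint, Fin.val_zero, add_zero, potential, lt_irrefl, h1, if_true, if_false,
      Nat.add_sub_cancel]
    push_cast
    rw [← hch]
    ring
  rw [hpot] at h
  exact h.trans (le_iSup₂_of_le (linePoint q ℓ 0) trivial
    (le_iSup₂_of_le (Fin.last (q + ℓ)) trivial le_rfl))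

end CliqueLine

end Hypergraph

/-! ### Choice of parameters and of the constant. -/

theorem mainTheorem5 :
    ∃ κ : ℝ≥0, 0 < κ ∧ ∀ n c : ℕ, 2 ≤ c → (c : ℝ) ≤ (n : ℝ) / 2 →
      ∃ H : Hypergraph (Fin n),
        H.vertexSet = Set.univ ∧ H.IsCliqueLineGluing c (n / 2 + 1) ∧
        H.Connected ∧ H.rank = c ∧
        H.radioCoverTime ≤ H.coverTime ∧
        H.maxRadioHittingTime ≤ H.radioCoverTime ∧
        (κ : ℝ≥0∞) * (H.edgeSet.ncard : ℝ≥0∞) * (n : ℝ≥0∞) * (c : ℝ≥0∞) ≤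
          H.maxRadioHittingTime := by
  -- The constant is `1 / 2 * 1 / 4`, from `m ≤ 2 * (q + 1).choose c` and `n ≤ 4 * (2 * ℓ - 1)`; the
  -- latter is an equality at `n = 4`.
  refine ⟨1 / 8, by norm_num, fun n c hc hcn => ?_⟩
  have hcn' : c * 2 ≤ n := by
    rw [le_div_iff₀ (by norm_num)] at hcn
    exact_mod_cast hcn
  obtain ⟨q, hq⟩ : ∃ q, n / 2 = q := ⟨_, rfl⟩
  obtain ⟨ℓ, rfl⟩ : ∃ ℓ, n = q + ℓ + 1 := ⟨n - q - 1, by omega⟩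
  have hcq : c ≤ q := by omega
  have hℓ : 1 ≤ ℓ := by omega
  refine ⟨Hypergraph.cliqueLine q ℓ c, rfl,
    by rw [hq]; exact Hypergraph.isCliqueLineGluing_cliqueLine,
    Hypergraph.connected_cliqueLine hc hcq, Hypergraph.rank_cliqueLine hc hcq,
    Hypergraph.radioCoverTime_le_coverTime _ fun x => ?_,
    Hypergraph.maxRadioHittingTime_le_radioCoverTime _,
    le_trans ?_ (Hypergraph.le_maxRadioHittingTime_cliqueLine hc hcq hℓ)⟩
  · rw [Hypergraph.edgesAt_cliqueLine]
    exact (Finset.coe_nonempty.2 (Hypergraph.edgesAt_cliqueLine_nonempty hc hcq x)).image _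
  · set m := (Hypergraph.cliqueLine q ℓ c).edgeSet.ncard
    have hm : m ≤ (q + 1).choose c + ℓ := Hypergraph.ncard_edgeSet_cliqueLine_le
    have hchoose := Hypergraph.le_choose_of_lt (m := q + 1) (k := c) (by omega) (by omega)
    have hm' : (m : ℝ) ≤ 2 * (q + 1).choose c := by
      exact_mod_cast (show m ≤ 2 * (q + 1).choose c by omega)
    have hn : ((q + ℓ + 1 : ℕ) : ℝ) ≤ 4 * (2 * ℓ - 1) := by
      have : q + ℓ + 1 + 4 ≤ 8 * ℓ := by omega
      have : ((q + ℓ + 1 : ℕ) : ℝ) + 4 ≤ 8 * ℓ := by exact_mod_cast this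
      linarith
    have hL : ((1 / 8 : ℝ≥0) : ℝ≥0∞) * m * ((q + ℓ + 1 : ℕ) : ℝ≥0∞) * c =
        ENNReal.ofReal (1 / 8 * m * (q + ℓ + 1 : ℕ) * c) := by
      rw [ENNReal.ofReal_mul (by positivity), ENNReal.ofReal_mul (by positivity),
        ENNReal.ofReal_mul (by positivity)]
      simp only [ENNReal.ofReal_natCast]
      congr 3
      rw [ENNReal.ofReal, ENNReal.coe_inj]
      ext
      simp
    rw [hL]
    refine ENNReal.ofReal_le_ofReal ?_
    have hprod := mul_le_mul hm' hn (by positivity) (by positivity)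
    have := mul_le_mul_of_nonneg_right hprod (Nat.cast_nonneg (α := ℝ) c)
    linarith
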